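/- **Setting.** Let $N\ge 1$ and $\Lambda=\mathrm{diag}(\lambda_1,\dots,\lambda_N)$ with $\lambda:=\min_i\lambda_i>0$, and let $K$ be the number of indices $i$ with $\lambda_i=\lambda$. Let $\mathcal A$ be a finite nonempty set of arms with feature vectors $x_a\in\mathbb R^N$, $\|x_a\|_2\le 1$. (For a weighted graph with Laplacian $\mathcal L=Q\Lambda_{\mathcal L}Q^{\mathsf T}$, $Q$ orthogonal: the arms are the nodes, $x_v$ is the $v$-th row of $Q$, $\Lambda=\Lambda_{\mathcal L}+\lambda I$, and $K$ is the number of zero eigenvalues of $\mathcal L$.) For a positive semidefinite matrix $M$ write $\|v\|_M=\sqrt{v^{\mathsf T}Mv}$. For a horizon $T$, the effective dimension is $$d=\left\lceil \frac{\max\log\prod_{i=1}^N(1+t_i/\lambda_i)}{\log(1+T/(K\lambda))}\right\rceil,$$ the maximum being over all real $t_1,\dots,t_N\ge 0$ with $\sum_i t_i=T$ (and $d=0$ if $T=0$). In each round $t=1,\dots,T$ the learner picks an arm $a_t$, which is $\mathcal F_{t-1}$-measurable, and observes $r_t=x_{a_t}^{\mathsf T}\alpha+\varepsilon_t$ with $\alpha\in\mathbb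 R^N$ unknown. Here $(\mathcal F_t)_{t\ge 0}$ is a filtration, $\varepsilon_t$ is $\mathcal F_t$-measurable, $\mathbb E[\varepsilon_t\mid\mathcal F_{t-1}]=0$, and $\mathbb E[e^{s\varepsilon_t}\mid\mathcal F_{t-1}]\le e^{R^2s^2/2}$ for all $s\in\mathbb R$, where $R\ge 0$. The regret is $R_T=T\max_{v}x_v^{\mathsf T}\alpha-\sum_{t=1}^T x_{a_t}^{\mathsf T}\alpha$. SpectralUCB with parameters $\lambda,R,C$ and $\delta\in(0,1)$ plays $$a_t\in\operatorname*{argmax}_a\left(x_a^{\mathsf T}\widehat\alpha_t+c\,\|x_a\|_{V_t^{-1}}\right)$$ (ties broken arbitrarily), where $V_t=\Lambda+\sum_{s<t}x_{a_s}x_{a_s}^{\mathsf T}$, $\widehat\alpha_t=V_t^{-1}\sum_{s<t}r_sx_{a_s}$, and $c=R\sqrt{2d\log(1+T/(K\lambda))+8\log(1/\delta)}+C$. **Theorem.** Assume $\|\alpha\|_\Lambda\le C$ and $x_a^{\mathsf T}\alpha\in[-1,1]$ for every arm $a$. Then with probability at least $1-\delta$ the regret of SpectralUCB satisfies $$R_T\le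 B_T:=\left(2R\sqrt{2d\log\left(1+\tfrac{T}{K\lambda}\right)+8\log\tfrac1\delta}+2C+2\right)\sqrt{2dT\log\left(1+\tfrac{T}{K\lambda}\right)}.$$ Moreover $B_T=\widetilde O(d\sqrt T)$: there are constants $A$ and $p$, depending only on $R,C,\lambda,\delta$, such that $B_T\le A\,d\sqrt T\,(\log T)^p$ for all $T\ge 2$. -/

import Mathlib

open MeasureTheory
open scoped Matrix

/-- A spectral bandit problem with regularization parameter `lam`: a positive diagonal
regularizer `Λ = diag (eig 0, …, eig (N - 1))` whose least entry is `lam`, and finitely many arms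
whose feature vectors lie in the Euclidean unit ball of `ℝ^N`. -/
structure SpectralBandit (N : ℕ) (Arm : Type*) (lam : ℝ) where
  /-- the diagonal entries of `Λ = Λ_L + lam • I` -/
  eig : Fin N → ℝ
  /-- the feature vectors `x_a` -/
  feature : Arm → Fin N → ℝ
  lam_pos : 0 < lam
  isLeast_lam : IsLeast (Set.range eig) lam
  norm_feature_le : ∀ a, ‖WithLp.toLp 2 (feature a)‖ ≤ 1

/-- The Laplacian `D - W` of a weighted graph with weight matrix `W`. -/
def graphLaplacian {N : ℕ} (W : Matrix (Fin N) (Fin N) ℝ) : Matrix (Fin N) (Fin N) ℝ :=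
  Matrix.diagonal (fun i => ∑ j, W i j) - W

theorem graphLaplacian_quadForm {N : ℕ} (W : Matrix (Fin N) (Fin N) ℝ) (hW : W.IsSymm)
    (f : Fin N → ℝ) :
    f ⬝ᵥ graphLaplacian W *ᵥ f = (1 / 2) * ∑ i, ∑ j, W i j * (f i - f j) ^ 2 := by
  have h1 : f ⬝ᵥ graphLaplacian W *ᵥ f
      = ∑ i, ∑ j, W i j * f i ^ 2 - ∑ i, ∑ j, W i j * (f i * f j) := by
    rw [graphLaplacian, Matrix.sub_mulVec, dotProduct_sub]
    congr 1
    · simp only [dotProduct, Matrix.mulVec_diagonal]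
      refine Finset.sum_congr rfl fun i _ => ?_
      rw [← Finset.sum_mul]; ring
    · simp only [dotProduct, Matrix.mulVec, Finset.mul_sum]
      exact Finset.sum_congr rfl fun i _ => Finset.sum_congr rfl fun j _ => by ring
  have h2 : ∑ i, ∑ j, W i j * f j ^ 2 = ∑ i, ∑ j, W i j * f i ^ 2 := by
    rw [Finset.sum_comm]
    exact Finset.sum_congr rfl fun i _ => Finset.sum_congr rfl fun j _ => by rw [hW.apply]
  have h3 : ∑ i, ∑ j, W i j * (f i - f j) ^ 2
      = ∑ i, ∑ j, W i j * f i ^ 2 - 2 * ∑ i, ∑ j, W i j * (f i * f j)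
        + ∑ i, ∑ j, W i j * f j ^ 2 := by
    simp only [Finset.mul_sum, ← Finset.sum_sub_distrib, ← Finset.sum_add_distrib]
    exact Finset.sum_congr rfl fun i _ => Finset.sum_congr rfl fun j _ => by ring
  rw [h1, h3, h2]; ring

/-- The spectral bandit problem of a weighted graph: from an eigendecomposition
`L = Q Λ_L Qᵀ` of its Laplacian, the arms are the nodes, `x_v` is the `v`-th row of `Q`, and
`Λ = Λ_L + lam • I`. -/
def SpectralBandit.ofGraph {N : ℕ} {lam : ℝ} (hN : 0 < N) (hlam : 0 < lam)
    (W : Matrix (Fin N) (Fin N) ℝ) (hsymm : W.IsSymm) (hnonneg : ∀ i j, 0 ≤ W i j)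
    (Q : Matrix (Fin N) (Fin N) ℝ) (hQ : Q ∈ Matrix.orthogonalGroup (Fin N) ℝ)
    (ev : Fin N → ℝ) (hL : graphLaplacian W = Q * Matrix.diagonal ev * Q.transpose) :
    SpectralBandit N (Fin N) lam where
  eig i := ev i + lam
  feature v := Q v
  lam_pos := hlam
  isLeast_lam := by
    have hQ1 : Q.transpose * Q = 1 := (Matrix.mem_orthogonalGroup_iff' (Fin N) ℝ).1 hQ
    have hQ2 : Q * Q.transpose = 1 := (Matrix.mem_orthogonalGroup_iff (Fin N) ℝ).1 hQ
    have hD : Q.transpose * graphLaplacian W * Q = Matrix.diagonal ev := by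
      rw [hL, ← Matrix.mul_assoc, ← Matrix.mul_assoc, hQ1, Matrix.one_mul, Matrix.mul_assoc, hQ1,
        Matrix.mul_one]
    have hev : ∀ i, 0 ≤ ev i := by
      intro i
      have h : ev i = (fun k => Q k i) ⬝ᵥ graphLaplacian W *ᵥ (fun k => Q k i) := by
        have := congrFun (congrFun hD i) i
        rw [Matrix.diagonal_apply_eq, Matrix.mul_assoc] at this
        rw [← this]; rfl
      rw [h, graphLaplacian_quadForm W hsymm]
      have : 0 ≤ ∑ i', ∑ j, W i' j * (Q i' i - Q j i) ^ 2 :=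
        Finset.sum_nonneg fun a _ => Finset.sum_nonneg fun b _ =>
          mul_nonneg (hnonneg a b) (sq_nonneg _)
      linarith
    have hzero : ∃ i, ev i = 0 := by
      by_contra! hne
      have h1 : graphLaplacian W *ᵥ (fun _ => (1 : ℝ)) = 0 := by
        funext i
        simp [graphLaplacian, Matrix.mulVec, dotProduct, Matrix.diagonal_apply]
      have hdet : (graphLaplacian W).det ≠ 0 := by
        have hq : Q.det * Q.transpose.det = 1 := by rw [← Matrix.det_mul, hQ2, Matrix.det_one]
        have hp : ∏ i, ev i ≠ 0 := Finset.prod_ne_zero_iff.2 fun i _ => hne i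
        rw [hL, Matrix.det_mul, Matrix.det_mul, Matrix.det_diagonal]
        have : Q.det * (∏ i, ev i) * Q.transpose.det = ∏ i, ev i := by
          rw [mul_right_comm, hq, one_mul]
        rwa [this]
      have h2 := Matrix.eq_zero_of_mulVec_eq_zero hdet h1
      exact one_ne_zero (congrFun h2 ⟨0, hN⟩)
    refine ⟨?_, ?_⟩
    · obtain ⟨i, hi⟩ := hzero
      exact ⟨i, by simp [hi]⟩
    · rintro _ ⟨i, rfl⟩
      have := hev i
      simp only
      linarith
  norm_feature_le v := by
    have hQ2 : Q * Q.transpose = 1 := (Matrix.mem_orthogonalGroup_iff (Fin N) ℝ).1 hQ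
    have h := congrFun (congrFun hQ2 v) v
    rw [Matrix.mul_apply, Matrix.one_apply_eq] at h
    rw [EuclideanSpace.norm_eq]
    have h' : ∑ i, ‖(WithLp.toLp 2 (Q v) : EuclideanSpace ℝ (Fin N)) i‖ ^ 2 = 1 := by
      rw [← h]
      exact Finset.sum_congr rfl fun i _ => by simp [sq]
    rw [h', Real.sqrt_one]

/-- The seminorm `‖v‖_M = √(vᵀ M v)`. -/
noncomputable def matNorm {N : ℕ} (M : Matrix (Fin N) (Fin N) ℝ) (v : Fin N → ℝ) : ℝ :=
  √(v ⬝ᵥ M *ᵥ v)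

namespace SpectralBandit

variable {N : ℕ} {Arm : Type*} {lam : ℝ}

/-- The diagonal matrix `Λ`. -/
def Lam (P : SpectralBandit N Arm lam) : Matrix (Fin N) (Fin N) ℝ :=
  Matrix.diagonal P.eig

open Classical in
/-- `K`, the number of zero eigenvalues of `Λ_L = Λ - lam • I`. -/
noncomputable def numZero (P : SpectralBandit N Arm lam) : ℕ :=
  (Finset.univ.filter fun i => P.eig i - lam = 0).card

/-- `log (1 + T / (K lam))`. -/
noncomputable def logTerm (P : SpectralBandit N Arm lam) (T : ℕ) : ℝ :=
  Real.log (1 + (T : ℝ) / (P.numZero * lam))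

/-- The effective dimension: the maximum of `log ∏ᵢ (1 + tᵢ / λᵢ)` over the nonnegative reals
`t₁, …, t_N` of sum `T`, divided by `log (1 + T / (K lam))` and rounded up. -/
noncomputable def effDim (P : SpectralBandit N Arm lam) (T : ℕ) : ℕ :=
  ⌈sSup ((fun t : Fin N → ℝ => Real.log (∏ i, (1 + t i / P.eig i))) ''
      {t | (∀ i, 0 ≤ t i) ∧ ∑ i, t i = (T : ℝ)}) / P.logTerm T⌉₊

/-- The confidence parameter `c` used by SpectralUCB. -/
noncomputable def confidence (P : SpectralBandit N Arm lam) (T : ℕ) (R C δ : ℝ) : ℝ :=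
  R * √(2 * P.effDim T * P.logTerm T + 8 * Real.log (1 / δ)) + C

/-- The mean reward `x_aᵀ α` of an arm. -/
def mean (P : SpectralBandit N Arm lam) (α : Fin N → ℝ) (a : Arm) : ℝ :=
  P.feature a ⬝ᵥ α

/-- `Λ + ∑_{s < t} x_{a_s} x_{a_s}ᵀ`. Rounds are numbered from `0`, so this is the matrix the
learner holds when choosing the arm `a t`. -/
def gram (P : SpectralBandit N Arm lam) (a : ℕ → Arm) (t : ℕ) : Matrix (Fin N) (Fin N) ℝ :=
  P.Lam + ∑ s ∈ Finset.range t, Matrix.vecMulVec (P.feature (a s)) (P.feature (a s))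

/-- The regularized least-squares estimate from the rounds `s < t`. -/
noncomputable def estimate (P : SpectralBandit N Arm lam) (a : ℕ → Arm) (r : ℕ → ℝ) (t : ℕ) :
    Fin N → ℝ :=
  (P.gram a t)⁻¹ *ᵥ ∑ s ∈ Finset.range t, r s • P.feature (a s)

/-- The upper confidence bound of the arm `b` at round `t`. -/
noncomputable def ucb (P : SpectralBandit N Arm lam) (c : ℝ) (a : ℕ → Arm) (r : ℕ → ℝ) (t : ℕ)
    (b : Arm) : ℝ :=
  P.feature b ⬝ᵥ P.estimate a r t + c * matNorm (P.gram a t)⁻¹ (P.feature b)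

/-- `a 0, …, a (T - 1)` are arms played by SpectralUCB when the observed rewards are
`r 0, …, r (T - 1)`: in each round the arm has the largest upper confidence bound (ties are broken
in any way). -/
def IsSpectralUCB (P : SpectralBandit N Arm lam) (T : ℕ) (R C δ : ℝ) (a : ℕ → Arm)
    (r : ℕ → ℝ) : Prop :=
  ∀ t < T, ∀ b, P.ucb (P.confidence T R C δ) a r t b ≤ P.ucb (P.confidence T R C δ) a r t (a t)

/-- The cumulative pseudo-regret after `T` rounds. -/
noncomputable def regret (P : SpectralBandit N Arm lam) (α : Fin N → ℝ) (T : ℕ)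
    (a : ℕ → Arm) : ℝ :=
  T * (⨆ v, P.mean α v) - ∑ t ∈ Finset.range T, P.mean α (a t)

/-- The right-hand side of the regret bound. -/
noncomputable def regretBound (P : SpectralBandit N Arm lam) (T : ℕ) (R C δ : ℝ) : ℝ :=
  (2 * R * √(2 * P.effDim T * P.logTerm T + 8 * Real.log (1 / δ)) + 2 * C + 2) *
    √(2 * P.effDim T * T * P.logTerm T)

end SpectralBandit

/-- The noise `ε 0, …, ε (T - 1)` is centered and `R`-sub-Gaussian conditionally on the past:
`ℱ t` is the information available when the arm of round `t` is chosen, and `ε t` is revealed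
after it. -/
structure IsCondSubGaussianNoise {Ω : Type*} {mΩ : MeasurableSpace Ω} (μ : Measure Ω)
    (ℱ : Filtration ℕ mΩ) (T : ℕ) (R : ℝ) (ε : ℕ → Ω → ℝ) : Prop where
  measurable : ∀ t < T, Measurable[ℱ (t + 1)] (ε t)
  integrable_exp : ∀ t < T, ∀ s : ℝ, Integrable (fun ω => Real.exp (s * ε t ω)) μ
  condExp_eq_zero : ∀ t < T, μ[ε t | ℱ t] =ᵐ[μ] 0
  condExp_exp_le : ∀ t < T, ∀ s : ℝ,
    μ[fun ω => Real.exp (s * ε t ω) | ℱ t] ≤ᵐ[μ] fun _ => Real.exp (R ^ 2 * s ^ 2 / 2)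

/-! The argument is optimism plus a self-normalized tail bound, with the effective dimension
controlling every determinant.

Write `S_t` for the sum of `ε_s x_{a_s}` over `s < t`. For fixed `θ`, the product of the factors
`exp (R⁻¹ (θ·x_s) ε_s - (θ·x_s)² / 2)` has expectation at most 1. Averaging over a Gaussian `θ` with
precision matrix `Λ` and completing the square yields `√(det Λ / det V_t) * exp (‖S_t‖² / (2R²))`,
the norm being that of `V_t⁻¹`. Stopping this mixture when it first reaches `1/δ` and applying
Markov's inequality bounds `‖S_t‖²` by `R² (log (det V_t / det Λ) + 2 log (1/δ))` for all `t ≤ T` at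
once (`measure_exists_mixInt_ge_le`, `sq_matNorm_le_of_mixInt_lt`).

By Hadamard's inequality `det V_t / det Λ` is at most a product `∏ (1 + t_i / λ_i)` with `∑ t_i ≤
T`, so its logarithm is at most `d log (1 + T / (Kλ))` (`log_det_gram_div_le`). This bounds the
confidence radius. It also bounds the sum of the squared widths `‖x_{a_t}‖²`, truncated at 1, since
`log det V_t` grows by `log (1 + ‖x_{a_t}‖²)` in each round. Optimism bounds the regret of a round
by a multiple of its truncated width, and Cauchy–Schwarz sums the rounds. -/

section LinearAlgebra

/-! ### Determinants and quadratic forms of positive definite matrices. -/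

variable {n : Type*} [Fintype n]

theorem Matrix.dotProduct_transpose_mul_self_mulVec (B : Matrix n n ℝ) (x y : n → ℝ) :
    x ⬝ᵥ (Bᵀ * B) *ᵥ y = (B *ᵥ x) ⬝ᵥ (B *ᵥ y) := by
  rw [← Matrix.mulVec_mulVec, Matrix.dotProduct_mulVec, Matrix.vecMul_transpose]

theorem Matrix.PosSemidef.dotProduct_mulVec_self_nonneg {A : Matrix n n ℝ} (hA : A.PosSemidef)
    (x : n → ℝ) : 0 ≤ x ⬝ᵥ A *ᵥ x := by
  simpa using hA.dotProduct_mulVec_nonneg x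

variable [DecidableEq n]

/-- **Hadamard's inequality** for positive definite matrices. -/
theorem Matrix.PosDef.det_le_prod_diag {A : Matrix n n ℝ} (hA : A.PosDef) :
    A.det ≤ ∏ i, A i i := by
  have hpos : ∀ i, 0 < A i i := fun i => hA.diag_pos
  -- Rescaling makes the diagonal 1, so the eigenvalues sum to `n`; then `x ≤ exp (x - 1)` bounds
  -- their product by `exp 0 = 1`.
  set D : Matrix n n ℝ := Matrix.diagonal fun i => (√(A i i))⁻¹ with hD
  have hs : ∀ i, 0 < √(A i i) := fun i => Real.sqrt_pos.2 (hpos i)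
  have hDet : D.det = (∏ i, √(A i i))⁻¹ := by
    rw [hD, Matrix.det_diagonal, Finset.prod_inv_distrib]
  have hP : 0 < ∏ i, √(A i i) := Finset.prod_pos fun i _ => hs i
  have hB : (Dᴴ * A * D).PosDef := by
    refine hA.conjTranspose_mul_mul_same ?_
    refine Matrix.mulVec_injective_of_isUnit ?_
    rw [Matrix.isUnit_iff_isUnit_det, hDet]
    exact (inv_pos.2 hP).ne'.isUnit
  have hdiag : ∀ i, (Dᴴ * A * D) i i = 1 := by
    intro i
    rw [hD, Matrix.diagonal_conjTranspose, Matrix.mul_diagonal, Matrix.diagonal_mul]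
    simp only [Pi.star_apply, star_trivial]
    have := Real.mul_self_sqrt (hpos i).le
    have h0 := (hs i).ne'
    field_simp
    nlinarith
  have htr : ∑ i, hB.isHermitian.eigenvalues i = Fintype.card n := by
    have h1 := hB.isHermitian.trace_eq_sum_eigenvalues
    have h2 : (Dᴴ * A * D).trace = Fintype.card n := by
      rw [Matrix.trace]
      simp only [Matrix.diag_apply, hdiag]
      simp
    rw [h2] at h1
    simpa using h1.symm
  have hdet : (Dᴴ * A * D).det ≤ 1 := by
    rw [hB.isHermitian.det_eq_prod_eigenvalues]
    calc ∏ i, ((hB.isHermitian.eigenvalues i : ℝ))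
        ≤ ∏ i, Real.exp (hB.isHermitian.eigenvalues i - 1) :=
          Finset.prod_le_prod (fun i _ => (hB.eigenvalues_pos i).le) fun i _ => by
            have := Real.add_one_le_exp (hB.isHermitian.eigenvalues i - 1)
            linarith
      _ = 1 := by
          rw [← Real.exp_sum, Finset.sum_sub_distrib, htr]
          simp
  have hsq : (∏ i, √(A i i)) * (∏ i, √(A i i)) = ∏ i, A i i := by
    rw [← Finset.prod_mul_distrib]
    exact Finset.prod_congr rfl fun i _ => Real.mul_self_sqrt (hpos i).le
  rw [Matrix.det_mul, Matrix.det_mul, Matrix.det_conjTranspose, star_trivial, hDet] at hdet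
  rw [← hsq]
  have h3 : (∏ i, √(A i i))⁻¹ * A.det * (∏ i, √(A i i))⁻¹
      = A.det / ((∏ i, √(A i i)) * (∏ i, √(A i i))) := by
    field_simp
  rw [h3, div_le_one (mul_pos hP hP)] at hdet
  exact hdet

theorem Matrix.det_add_vecMulVec_self {A : Matrix n n ℝ} (hA : IsUnit A.det) (x : n → ℝ) :
    (A + Matrix.vecMulVec x x).det = A.det * (1 + x ⬝ᵥ A⁻¹ *ᵥ x) := by
  have h := Matrix.det_add_replicateCol_mul_replicateRow (ι := Unit) hA x x
  rw [← Matrix.vecMulVec_eq] at h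
  rw [h]
  congr 1
  rw [Matrix.mul_assoc, Matrix.det_unique, Matrix.add_apply, Matrix.one_apply_eq]
  rfl

theorem Matrix.PosSemidef.exists_eq_transpose_mul_self {A : Matrix n n ℝ} (hA : A.PosSemidef) :
    ∃ B : Matrix n n ℝ, A = Bᵀ * B := by
  open scoped MatrixOrder in
  obtain ⟨B, hB⟩ := CStarAlgebra.nonneg_iff_eq_star_mul_self.1 hA.nonneg
  exact ⟨B, by rw [hB, Matrix.star_eq_conjTranspose, Matrix.conjTranspose_eq_transpose_of_trivial]⟩

theorem Matrix.PosSemidef.dotProduct_mulVec_comm {A : Matrix n n ℝ} (hA : A.PosSemidef)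
    (x y : n → ℝ) : x ⬝ᵥ A *ᵥ y = y ⬝ᵥ A *ᵥ x := by
  obtain ⟨B, rfl⟩ := hA.exists_eq_transpose_mul_self
  rw [dotProduct_transpose_mul_self_mulVec, dotProduct_transpose_mul_self_mulVec, dotProduct_comm]

end LinearAlgebra

/-- The Cauchy–Schwarz inequality for the seminorm `matNorm`. -/
theorem abs_dotProduct_mulVec_le_matNorm_mul {N : ℕ} {M : Matrix (Fin N) (Fin N) ℝ}
    (hM : M.PosSemidef) (x y : Fin N → ℝ) :
    |x ⬝ᵥ M *ᵥ y| ≤ matNorm M x * matNorm M y := by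
  obtain ⟨B, rfl⟩ := hM.exists_eq_transpose_mul_self
  simp only [matNorm, Matrix.dotProduct_transpose_mul_self_mulVec]
  have h0 : 0 ≤ (B *ᵥ x) ⬝ᵥ (B *ᵥ x) := Finset.sum_nonneg fun i _ => mul_self_nonneg _
  rw [← Real.sqrt_mul h0]
  refine Real.abs_le_sqrt ?_
  simp only [dotProduct]
  simpa [sq] using Finset.sum_mul_sq_le_sq_mul_sq Finset.univ (B *ᵥ x) (B *ᵥ y)

theorem matNorm_nonneg {N : ℕ} (M : Matrix (Fin N) (Fin N) ℝ) (x : Fin N → ℝ) :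
    0 ≤ matNorm M x := Real.sqrt_nonneg _

theorem sq_matNorm {N : ℕ} {M : Matrix (Fin N) (Fin N) ℝ} (hM : M.PosSemidef) (x : Fin N → ℝ) :
    matNorm M x ^ 2 = x ⬝ᵥ M *ᵥ x :=
  Real.sq_sqrt (hM.dotProduct_mulVec_self_nonneg x)

/-- If `L ≤ L + G` in the Loewner order, then `‖L y‖_{(L + G)⁻¹} ≤ ‖y‖_L`. -/
theorem matNorm_inv_add_mulVec_le {N : ℕ} {L G : Matrix (Fin N) (Fin N) ℝ} (hL : L.PosDef)
    (hG : G.PosSemidef) (y : Fin N → ℝ) :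
    matNorm (L + G)⁻¹ (L *ᵥ y) ≤ matNorm L y := by
  have hV : (L + G).PosDef := hL.add_posSemidef hG
  refine Real.sqrt_le_sqrt ?_
  -- The claim is `zᵀLy ≤ yᵀLy`. Positivity at `z - y` gives `2 zᵀLy ≤ zᵀLz + yᵀLy`, and `zᵀLz ≤
  -- zᵀ(L + G)z = zᵀLy`.
  set z := (L + G)⁻¹ *ᵥ (L *ᵥ y) with hz
  have hVz : (L + G) *ᵥ z = L *ᵥ y := by
    rw [hz, Matrix.mulVec_mulVec, Matrix.mul_nonsing_inv _ hV.det_pos.ne'.isUnit, Matrix.one_mulVec]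
  have h1 : z ⬝ᵥ (L + G) *ᵥ z = z ⬝ᵥ L *ᵥ y := by rw [hVz]
  have h2 := hL.posSemidef.dotProduct_mulVec_self_nonneg (z - y)
  have h3 := hG.dotProduct_mulVec_self_nonneg z
  have h4 := hL.posSemidef.dotProduct_mulVec_comm z y
  rw [Matrix.add_mulVec, dotProduct_add] at h1
  simp only [Matrix.mulVec_sub, dotProduct_sub, sub_dotProduct] at h2
  rw [dotProduct_comm (L *ᵥ y) z]
  linarith

/-! ### Gaussian integrals. -/

section Gaussian

variable {N : ℕ}

/-- The unnormalized Gaussian integral `∫ exp (θᵀ S - θᵀ A θ / 2) dθ`. -/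
noncomputable def gaussInt (A : Matrix (Fin N) (Fin N) ℝ) (S : Fin N → ℝ) : ENNReal :=
  ∫⁻ θ : Fin N → ℝ, ENNReal.ofReal (Real.exp (θ ⬝ᵥ S - (θ ⬝ᵥ A *ᵥ θ) / 2))

/-- The value of this normalizing constant is never needed: it occurs on both sides of the final
comparison and cancels once it is nonzero and finite. -/
theorem lintegral_exp_neg_sq_ne_zero :
    ∫⁻ θ : Fin N → ℝ, ENNReal.ofReal (Real.exp (-(θ ⬝ᵥ θ) / 2)) ≠ 0 := by
  intro h
  rw [lintegral_eq_zero_iff (by fun_prop)] at h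
  have : ∀ θ : Fin N → ℝ, ENNReal.ofReal (Real.exp (-(θ ⬝ᵥ θ) / 2)) ≠ 0 := fun θ => by
    simp [Real.exp_pos]
  obtain ⟨θ, hθ⟩ := h.exists
  exact this θ hθ

theorem lintegral_exp_neg_sq_ne_top :
    ∫⁻ θ : Fin N → ℝ, ENNReal.ofReal (Real.exp (-(θ ⬝ᵥ θ) / 2)) ≠ ⊤ := by
  have h1 : Integrable fun x : ℝ => Real.exp (-(1 / 2) * x ^ 2) :=
    integrable_exp_neg_mul_sq (by norm_num)
  have h2 : Integrable fun θ : Fin N → ℝ => ∏ i, Real.exp (-(1 / 2) * θ i ^ 2) :=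
    Integrable.fintype_prod fun _ => h1
  have h3 : (fun θ : Fin N → ℝ => Real.exp (-(θ ⬝ᵥ θ) / 2))
      = fun θ : Fin N → ℝ => ∏ i, Real.exp (-(1 / 2) * θ i ^ 2) := by
    funext θ
    rw [← Real.exp_sum, ← Finset.mul_sum]
    congr 1
    simp only [dotProduct, sq]
    ring
  rw [← h3] at h2
  exact ((hasFiniteIntegral_iff_ofReal (Filter.Eventually.of_forall fun _ =>
    (Real.exp_pos _).le)).1 h2.2).ne

/-- Factor `A = Bᵀ B` and substitute `Bθ`; the Jacobian factor is `|det B|⁻¹ = (√(det A))⁻¹`. -/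
theorem gaussInt_zero_right {A : Matrix (Fin N) (Fin N) ℝ} (hA : A.PosDef) :
    gaussInt A 0 = ENNReal.ofReal (√A.det)⁻¹ *
      ∫⁻ θ : Fin N → ℝ, ENNReal.ofReal (Real.exp (-(θ ⬝ᵥ θ) / 2)) := by
  obtain ⟨B, hB⟩ := hA.posSemidef.exists_eq_transpose_mul_self
  have hdet : A.det = B.det ^ 2 := by rw [hB, Matrix.det_mul, Matrix.det_transpose, sq]
  have hB0 : B.det ≠ 0 := by
    intro h
    have := hA.det_pos
    rw [hdet, h] at this
    simp at this
  have hmap := Real.map_matrix_volume_pi_eq_smul_volume_pi hB0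
  have hmeas : Measurable (Matrix.toLin' B) :=
    (Matrix.toLin' B).continuous_of_finiteDimensional.measurable
  have hint : gaussInt A 0 = ∫⁻ θ, ENNReal.ofReal (Real.exp (-(θ ⬝ᵥ θ) / 2))
      ∂(Measure.map (Matrix.toLin' B) volume) := by
    rw [lintegral_map (by fun_prop) hmeas, gaussInt]
    refine lintegral_congr fun θ => ?_
    rw [hB, Matrix.dotProduct_transpose_mul_self_mulVec, dotProduct_zero, zero_sub,
      Matrix.toLin'_apply, neg_div]
  rw [hint, hmap, lintegral_smul_measure, smul_eq_mul, hdet, Real.sqrt_sq_eq_abs, abs_inv]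

/-- Complete the square around `A⁻¹ S`, then use translation invariance of Lebesgue measure. -/
theorem gaussInt_eq {A : Matrix (Fin N) (Fin N) ℝ} (hA : A.PosDef) (S : Fin N → ℝ) :
    gaussInt A S = ENNReal.ofReal (Real.exp (matNorm A⁻¹ S ^ 2 / 2)) * gaussInt A 0 := by
  have hU : IsUnit A.det := hA.det_pos.ne'.isUnit
  set m := A⁻¹ *ᵥ S with hm
  have hAm : A *ᵥ m = S := by
    rw [hm, Matrix.mulVec_mulVec, Matrix.mul_nonsing_inv _ hU, Matrix.one_mulVec]
  have hnorm : matNorm A⁻¹ S ^ 2 = m ⬝ᵥ S := by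
    rw [sq_matNorm hA.inv.posSemidef, dotProduct_comm]
  rw [hnorm, gaussInt, gaussInt, ← lintegral_add_right_eq_self _ m,
    ← lintegral_const_mul _ (by fun_prop)]
  refine lintegral_congr fun θ => ?_
  rw [← ENNReal.ofReal_mul (Real.exp_pos _).le, ← Real.exp_add]
  congr 2
  have h4 := hA.posSemidef.dotProduct_mulVec_comm m θ
  simp only [Matrix.mulVec_add, dotProduct_add, add_dotProduct, dotProduct_zero, hAm] at h4 ⊢
  rw [h4]
  ring

end Gaussian

/-! ### Exponential supermartingales. -/

section Supermartingale

variable {Ω : Type*} {m mΩ : MeasurableSpace Ω} {μ : Measure Ω}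

/-- Here `g` need not be integrable, so instead of pulling it out of a conditional expectation the
proof compares measures on `m`: the one with density `f`, restricted to `m`, is at most `c` times
`μ`. -/
theorem lintegral_mul_le_of_condExp_le [IsFiniteMeasure μ] (hm : m ≤ mΩ)
    {f : Ω → ℝ} (hf : Measurable f) (hf0 : ∀ ω, 0 ≤ f ω) (hfi : Integrable f μ) {c : ℝ}
    (hc : μ[f | m] ≤ᵐ[μ] fun _ => c) (hc0 : 0 ≤ c) {g : Ω → ENNReal} (hg : Measurable[m] g) :
    ∫⁻ ω, g ω * ENNReal.ofReal (f ω) ∂μ ≤ ENNReal.ofReal c * ∫⁻ ω, g ω ∂μ := by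
  have hle : (μ.withDensity fun ω => ENNReal.ofReal (f ω)).trim hm
      ≤ ENNReal.ofReal c • μ.trim hm := by
    refine Measure.le_iff.2 fun s hs => ?_
    rw [Measure.smul_apply, trim_measurableSet_eq hm hs, trim_measurableSet_eq hm hs,
      withDensity_apply _ (hm s hs),
      ← ofReal_integral_eq_lintegral_ofReal hfi.integrableOn (Filter.Eventually.of_forall hf0),
      ← setIntegral_condExp hm hfi hs, smul_eq_mul]
    have h1 : ∫ ω in s, (μ[f | m]) ω ∂μ ≤ ∫ _ in s, c ∂μ :=
      integral_mono_ae integrable_condExp.integrableOn (integrable_const _)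
        (ae_restrict_of_ae hc)
    rw [setIntegral_const, smul_eq_mul] at h1
    refine (ENNReal.ofReal_le_ofReal h1).trans ?_
    rw [mul_comm, ENNReal.ofReal_mul hc0, ofReal_measureReal]
  have hgm : Measurable g := hg.mono hm le_rfl
  calc ∫⁻ ω, g ω * ENNReal.ofReal (f ω) ∂μ
      = ∫⁻ ω, g ω ∂(μ.withDensity fun ω => ENNReal.ofReal (f ω)) := by
        rw [lintegral_withDensity_eq_lintegral_mul _ hf.ennreal_ofReal hgm]
        simp [mul_comm]
    _ = ∫⁻ ω, g ω ∂((μ.withDensity fun ω => ENNReal.ofReal (f ω)).trim hm) :=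
        (lintegral_trim hm hg).symm
    _ ≤ ∫⁻ ω, g ω ∂(ENNReal.ofReal c • μ.trim hm) := lintegral_mono' hle le_rfl
    _ = ENNReal.ofReal c * ∫⁻ ω, g ω ∂μ := by
        rw [lintegral_smul_measure, lintegral_trim hm hg, smul_eq_mul]

/-- The exponential supermartingale increment `exp (s ε - R² s² / 2)`. -/
noncomputable def expIncr (R s e : ℝ) : ENNReal :=
  ENNReal.ofReal (Real.exp (s * e - R ^ 2 * s ^ 2 / 2))

theorem measurable_expIncr {m : MeasurableSpace Ω} (R : ℝ) {s e : Ω → ℝ} (hs : Measurable s)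
    (he : Measurable e) : Measurable fun ω => expIncr R (s ω) (e ω) := by
  unfold expIncr
  fun_prop

/-- The sub-Gaussian bound is for deterministic `s`. A predictable `s` with finitely many values
reduces to it by splitting along the events `s = v`; finitely many arms guarantee this finiteness.
-/
theorem lintegral_mul_expIncr_le [IsFiniteMeasure μ] (hm : m ≤ mΩ) {R : ℝ}
    {e : Ω → ℝ} (he : Measurable e)
    (hint : ∀ s : ℝ, Integrable (fun ω => Real.exp (s * e ω)) μ)
    (hsub : ∀ s : ℝ, μ[fun ω => Real.exp (s * e ω) | m] ≤ᵐ[μ] fun _ => Real.exp (R ^ 2 * s ^ 2 / 2))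
    {s : Ω → ℝ} (hs : Measurable[m] s) (hfin : (Set.range s).Finite)
    {g : Ω → ENNReal} (hg : Measurable[m] g) :
    ∫⁻ ω, g ω * expIncr R (s ω) (e ω) ∂μ ≤ ∫⁻ ω, g ω ∂μ := by
  classical
  have hset : ∀ v, MeasurableSet[m] (s ⁻¹' {v}) := fun v => hs (measurableSet_singleton v)
  have hpart : ∀ F : Ω → ENNReal, ∀ ω,
      F ω = ∑ v ∈ hfin.toFinset, (s ⁻¹' {v}).indicator F ω := by
    intro F ω
    rw [Finset.sum_eq_single (s ω)]
    · simp
    · intro v _ hv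
      exact Set.indicator_of_notMem (fun h => hv (by simpa using h.symm)) _
    · simp
  have hgm : Measurable g := hg.mono hm le_rfl
  have hv : ∀ v, ∫⁻ ω, (s ⁻¹' {v}).indicator (fun ω => g ω * expIncr R (s ω) (e ω)) ω ∂μ
      ≤ ∫⁻ ω, (s ⁻¹' {v}).indicator g ω ∂μ := by
    intro v
    set c := Real.exp (R ^ 2 * v ^ 2 / 2) with hc
    have hc0 : 0 < c := Real.exp_pos _
    have h1 := lintegral_mul_le_of_condExp_le hm (f := fun ω => Real.exp (v * e ω)) (by fun_prop)
      (fun ω => (Real.exp_pos _).le) (hint v) (hsub v) hc0.le (hg.indicator (hset v))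
    have h2 : ∀ ω, (s ⁻¹' {v}).indicator (fun ω => g ω * expIncr R (s ω) (e ω)) ω
        = ENNReal.ofReal c⁻¹ *
          ((s ⁻¹' {v}).indicator g ω * ENNReal.ofReal (Real.exp (v * e ω))) := by
      intro ω
      by_cases h : s ω = v
      · have hmem : ω ∈ s ⁻¹' {v} := h
        rw [Set.indicator_of_mem hmem, Set.indicator_of_mem hmem, h, expIncr, mul_left_comm,
          ← ENNReal.ofReal_mul (inv_pos.2 hc0).le, hc, ← Real.exp_neg, ← Real.exp_add]
        congr 3
        ring
      · have hmem : ω ∉ s ⁻¹' {v} := h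
        rw [Set.indicator_of_notMem hmem, Set.indicator_of_notMem hmem]
        simp
    simp_rw [h2]
    have hind : Measurable ((s ⁻¹' {v}).indicator g) := hgm.indicator (hm _ (hset v))
    rw [lintegral_const_mul _ (by fun_prop)]
    calc _ ≤ ENNReal.ofReal c⁻¹ *
          (ENNReal.ofReal c * ∫⁻ ω, (s ⁻¹' {v}).indicator g ω ∂μ) := by gcongr
      _ = _ := by
        rw [← mul_assoc, ← ENNReal.ofReal_mul (inv_pos.2 hc0).le, inv_mul_cancel₀ hc0.ne']
        simp
  have hsm : Measurable s := hs.mono hm le_rfl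
  have hM : Measurable fun ω => g ω * expIncr R (s ω) (e ω) :=
    hgm.mul (measurable_expIncr R hsm he)
  calc ∫⁻ ω, g ω * expIncr R (s ω) (e ω) ∂μ
      = ∑ v ∈ hfin.toFinset,
          ∫⁻ ω, (s ⁻¹' {v}).indicator (fun ω => g ω * expIncr R (s ω) (e ω)) ω ∂μ := by
        rw [← lintegral_finsetSum _ fun v _ => hM.indicator (hm _ (hset v))]
        exact lintegral_congr fun ω => hpart (fun ω => g ω * expIncr R (s ω) (e ω)) ω
    _ ≤ ∑ v ∈ hfin.toFinset, ∫⁻ ω, (s ⁻¹' {v}).indicator g ω ∂μ := Finset.sum_le_sum fun v _ => hv v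
    _ = ∫⁻ ω, g ω ∂μ := by
        rw [← lintegral_finsetSum _ fun v _ => hgm.indicator (hm _ (hset v))]
        exact lintegral_congr fun ω => (hpart g ω).symm

theorem lintegral_prod_expIncr_le_one [IsProbabilityMeasure μ] {ℱ : Filtration ℕ mΩ} {T : ℕ} {R : ℝ}
    {ε : ℕ → Ω → ℝ} (hε : IsCondSubGaussianNoise μ ℱ T R ε) {s : ℕ → Ω → ℝ}
    (hs : ∀ t < T, Measurable[ℱ t] (s t)) (hfin : ∀ t < T, (Set.range (s t)).Finite) {t : ℕ}
    (ht : t ≤ T) :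
    ∫⁻ ω, ∏ u ∈ Finset.range t, expIncr R (s u ω) (ε u ω) ∂μ ≤ 1 := by
  induction t with
  | zero => simp
  | succ t ih =>
    simp_rw [Finset.prod_range_succ]
    refine le_trans ?_ (ih (by omega))
    refine lintegral_mul_expIncr_le (ℱ.le t)
      ((hε.measurable t ht).mono (ℱ.le _) le_rfl) (hε.integrable_exp t ht) (hε.condExp_exp_le t ht)
      (hs t ht) (hfin t ht) ?_
    refine Finset.measurable_prod _ fun u hu => ?_
    rw [Finset.mem_range] at hu
    exact measurable_expIncr (m := ℱ t) R ((hs u (by omega)).mono (ℱ.mono (by omega)) le_rfl)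
      ((hε.measurable u (by omega)).mono (ℱ.mono (by omega)) le_rfl)

end Supermartingale

/-! ### The method of mixtures and the self-normalized bound. -/

section Mixture

variable {N : ℕ}

/-- The Gaussian mixture of the exponential supermartingales with directions `x` and noise `e`,
up to normalization. -/
noncomputable def mixInt (L : Matrix (Fin N) (Fin N) ℝ) (R : ℝ) (x : ℕ → Fin N → ℝ) (e : ℕ → ℝ)
    (t : ℕ) : ENNReal :=
  gaussInt (L + ∑ s ∈ Finset.range t, Matrix.vecMulVec (x s) (x s))
    (R⁻¹ • ∑ s ∈ Finset.range t, e s • x s)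

theorem mixInt_eq_lintegral_prod (L : Matrix (Fin N) (Fin N) ℝ) {R : ℝ} (hR : R ≠ 0)
    (x : ℕ → Fin N → ℝ) (e : ℕ → ℝ) (t : ℕ) :
    mixInt L R x e t = ∫⁻ θ : Fin N → ℝ, ENNReal.ofReal (Real.exp (-(θ ⬝ᵥ L *ᵥ θ) / 2)) *
      ∏ s ∈ Finset.range t, expIncr R (R⁻¹ * θ ⬝ᵥ x s) (e s) := by
  refine lintegral_congr fun θ => ?_
  simp only [expIncr]
  rw [← ENNReal.ofReal_prod_of_nonneg fun _ _ => (Real.exp_pos _).le, ← Real.exp_sum,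
    ← ENNReal.ofReal_mul (Real.exp_pos _).le, ← Real.exp_add]
  congr 2
  rw [Matrix.add_mulVec, dotProduct_add, dotProduct_smul, dotProduct_sum, Matrix.sum_mulVec,
    dotProduct_sum, Finset.sum_sub_distrib, smul_eq_mul, Finset.mul_sum, neg_div, add_div,
    Finset.sum_div]
  have h1 : ∀ s, R⁻¹ * θ ⬝ᵥ e s • x s = R⁻¹ * θ ⬝ᵥ x s * e s := fun s => by
    rw [dotProduct_smul, smul_eq_mul]; ring
  have h2 : ∀ s, (θ ⬝ᵥ Matrix.vecMulVec (x s) (x s) *ᵥ θ) / 2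
      = R ^ 2 * (R⁻¹ * θ ⬝ᵥ x s) ^ 2 / 2 := fun s => by
    rw [Matrix.vecMulVec_mulVec, dotProduct_comm (x s) θ]
    simp only [dotProduct_smul, MulOpposite.smul_eq_mul_unop, MulOpposite.unop_op]
    field_simp
  simp_rw [h1, h2]
  ring

variable {Ω : Type*}

theorem measurable_mixture_integrand {m : MeasurableSpace Ω} (L : Matrix (Fin N) (Fin N) ℝ) {R : ℝ}
    {x : ℕ → Ω → Fin N → ℝ} {ε : ℕ → Ω → ℝ} {t : ℕ} (hx : ∀ s < t, Measurable (x s))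
    (hε : ∀ s < t, Measurable (ε s)) :
    Measurable fun p : Ω × (Fin N → ℝ) =>
      ENNReal.ofReal (Real.exp (-(p.2 ⬝ᵥ L *ᵥ p.2) / 2)) *
        ∏ s ∈ Finset.range t, expIncr R (R⁻¹ * p.2 ⬝ᵥ x s p.1) (ε s p.1) := by
  refine Measurable.mul ?_ (Finset.measurable_prod _ fun s hs => ?_)
  · have : Measurable fun θ : Fin N → ℝ => ENNReal.ofReal (Real.exp (-(θ ⬝ᵥ L *ᵥ θ) / 2)) := by
      fun_prop
    exact this.comp measurable_snd
  · rw [Finset.mem_range] at hs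
    refine measurable_expIncr R (Measurable.const_mul ?_ _) ((hε s hs).comp measurable_fst)
    simp only [dotProduct]
    refine Finset.measurable_sum _ fun i _ => Measurable.mul ?_ ?_
    · exact (measurable_pi_apply i).comp measurable_snd
    · exact (measurable_pi_apply i).comp ((hx s hs).comp measurable_fst)

theorem measurable_mixInt {m : MeasurableSpace Ω} (L : Matrix (Fin N) (Fin N) ℝ) {R : ℝ}
    (hR : R ≠ 0) {x : ℕ → Ω → Fin N → ℝ} {ε : ℕ → Ω → ℝ} {t : ℕ} (hx : ∀ s < t, Measurable (x s))
    (hε : ∀ s < t, Measurable (ε s)) :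
    Measurable fun ω => mixInt L R (fun s => x s ω) (fun s => ε s ω) t := by
  simp_rw [mixInt_eq_lintegral_prod L hR]
  exact (measurable_mixture_integrand L hx hε).lintegral_prod_right'

variable {mΩ : MeasurableSpace Ω} {μ : Measure Ω} [IsProbabilityMeasure μ] {ℱ : Filtration ℕ mΩ}
  {T : ℕ} {R : ℝ} {ε : ℕ → Ω → ℝ}

/-- By Tonelli the expectation moves inside the integral over `θ`, where the product of increments
has mean at most 1. -/
theorem lintegral_mixInt_le (hε : IsCondSubGaussianNoise μ ℱ T R ε) (hR : R ≠ 0)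
    (L : Matrix (Fin N) (Fin N) ℝ) {x : ℕ → Ω → Fin N → ℝ} (hx : ∀ t < T, Measurable[ℱ t] (x t))
    (hfin : ∀ t < T, (Set.range (x t)).Finite) :
    ∫⁻ ω, mixInt L R (fun s => x s ω) (fun s => ε s ω) T ∂μ ≤ gaussInt L 0 := by
  have hxm : ∀ s < T, Measurable (x s) := fun s hs => (hx s hs).mono (ℱ.le _) le_rfl
  have hεm : ∀ s < T, Measurable (ε s) := fun s hs => (hε.measurable s hs).mono (ℱ.le _) le_rfl
  have hjoint := measurable_mixture_integrand L (R := R) hxm hεm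
  simp_rw [mixInt_eq_lintegral_prod L hR]
  rw [lintegral_lintegral_swap hjoint.aemeasurable, gaussInt]
  refine lintegral_mono fun θ => ?_
  have hdot : Continuous fun y : Fin N → ℝ => R⁻¹ * θ ⬝ᵥ y := by fun_prop
  have h1 := lintegral_prod_expIncr_le_one hε (s := fun t ω => R⁻¹ * θ ⬝ᵥ x t ω)
    (fun t ht => hdot.measurable.comp (hx t ht))
    (fun t ht => by
      refine ((hfin t ht).image fun y => R⁻¹ * θ ⬝ᵥ y).subset ?_
      rintro _ ⟨ω, rfl⟩
      exact ⟨x t ω, ⟨ω, rfl⟩, rfl⟩) le_rfl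
  rw [lintegral_const_mul _ (Finset.measurable_prod _ fun s hs => by
    rw [Finset.mem_range] at hs
    exact measurable_expIncr R (hdot.measurable.comp (hxm s hs)) (hεm s hs))]
  rw [dotProduct_zero, zero_sub, ← neg_div]
  exact mul_le_of_le_one_right' h1

theorem gaussInt_zero_ne_zero {L : Matrix (Fin N) (Fin N) ℝ} (hL : L.PosDef) :
    gaussInt L 0 ≠ 0 := by
  rw [gaussInt_zero_right hL]
  refine mul_ne_zero ?_ lintegral_exp_neg_sq_ne_zero
  have := hL.det_pos
  simp [this]

theorem gaussInt_zero_ne_top {L : Matrix (Fin N) (Fin N) ℝ} (hL : L.PosDef) :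
    gaussInt L 0 ≠ ⊤ := by
  rw [gaussInt_zero_right hL]
  exact ENNReal.mul_ne_top ENNReal.ofReal_ne_top lintegral_exp_neg_sq_ne_top

theorem sum_range_ite_find {M : Type*} [AddCommMonoid M] {p : ℕ → Prop} [DecidablePred p]
    (h : ∃ t, p t) {T : ℕ} (hT : Nat.find h ≤ T) [∀ s, Decidable (∃ u ≤ s, p u)] (f : ℕ → M) :
    ∑ s ∈ Finset.range T, (if ∃ u ≤ s, p u then 0 else f s)
      = ∑ s ∈ Finset.range (Nat.find h), f s := by
  rw [← Finset.sum_subset (Finset.range_mono hT)]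
  · refine Finset.sum_congr rfl fun s hs => if_neg ?_
    rintro ⟨u, hu, hp⟩
    have := Nat.find_min' h hp
    rw [Finset.mem_range] at hs
    omega
  · intro s _ hs
    rw [Finset.mem_range, not_lt] at hs
    exact if_pos ⟨_, hs, Nat.find_spec h⟩

/-- The maximal inequality for the Gaussian mixture. -/
theorem measure_exists_mixInt_ge_le (hε : IsCondSubGaussianNoise μ ℱ T R ε) (hR : R ≠ 0)
    {L : Matrix (Fin N) (Fin N) ℝ} (hL : L.PosDef) {x : ℕ → Ω → Fin N → ℝ}
    (hx : ∀ t < T, Measurable[ℱ t] (x t)) (hfin : ∀ t < T, (Set.range (x t)).Finite)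
    (c : ENNReal) :
    μ {ω | ∃ t ≤ T, gaussInt L 0 ≤ c * mixInt L R (fun s => x s ω) (fun s => ε s ω) t} ≤ c := by
  classical
  set p : Ω → ℕ → Prop := fun ω t =>
    gaussInt L 0 ≤ c * mixInt L R (fun s => x s ω) (fun s => ε s ω) t with hp
  -- Stopping is done by zeroing the directions from the first crossing on. This keeps them
  -- predictable, and since the noise enters only through `ε s • x s`, the mixture at time `T`
  -- equals its value at the crossing. Markov's inequality at the single time `T` then suffices.
  set x' : ℕ → Ω → Fin N → ℝ := fun s ω => if ∃ u ≤ s, p ω u then 0 else x s ω with hx'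
  have hpm : ∀ t < T, MeasurableSet[ℱ t] {ω | ∃ u ≤ t, p ω u} := by
    intro t ht
    have hu : ∀ u ≤ t, MeasurableSet[ℱ t] {ω | p ω u} := by
      intro u hu
      refine measurableSet_le measurable_const (Measurable.const_mul ?_ _)
      exact measurable_mixInt (m := ℱ t) L hR
        (fun s hs => (hx s (by omega)).mono (ℱ.mono (by omega)) le_rfl)
        (fun s hs => (hε.measurable s (by omega)).mono (ℱ.mono (by omega)) le_rfl)
    have : {ω | ∃ u ≤ t, p ω u} = ⋃ u ∈ Finset.range (t + 1), {ω | p ω u} := by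
      ext ω
      simp
    rw [this]
    exact Finset.measurableSet_biUnion _ fun u hu' => hu u (by simpa [Nat.lt_succ_iff] using hu')
  have hx'm : ∀ t < T, Measurable[ℱ t] (x' t) := fun t ht =>
    Measurable.ite (hpm t ht) measurable_const (hx t ht)
  have hx'fin : ∀ t < T, (Set.range (x' t)).Finite := by
    intro t ht
    refine ((hfin t ht).insert 0).subset ?_
    rintro _ ⟨ω, rfl⟩
    by_cases h : ∃ u ≤ t, p ω u
    · simp only [hx', if_pos h, Set.mem_insert_iff, true_or]
    · simp only [hx', if_neg h]
      exact Or.inr ⟨ω, rfl⟩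
  have hsub : {ω | ∃ t ≤ T, p ω t} ⊆
      {ω | gaussInt L 0 ≤ c * mixInt L R (fun s => x' s ω) (fun s => ε s ω) T} := by
    rintro ω ⟨t, ht, hpt⟩
    have hex : ∃ t, p ω t := ⟨t, hpt⟩
    have hT : Nat.find hex ≤ T := (Nat.find_min' hex hpt).trans ht
    have h1 : mixInt L R (fun s => x' s ω) (fun s => ε s ω) T
        = mixInt L R (fun s => x s ω) (fun s => ε s ω) (Nat.find hex) := by
      rw [mixInt, mixInt, ← sum_range_ite_find hex hT fun s => Matrix.vecMulVec (x s ω) (x s ω),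
        ← sum_range_ite_find hex hT fun s => ε s ω • x s ω]
      congr 2
      · refine Finset.sum_congr rfl fun s _ => ?_
        simp only [hx']
        split_ifs <;> simp
      · refine Finset.sum_congr rfl fun s _ => ?_
        simp only [hx']
        split_ifs <;> simp
    rw [Set.mem_ofPred_eq, h1]
    exact Nat.find_spec hex
  have hm : Measurable fun ω => c * mixInt L R (fun s => x' s ω) (fun s => ε s ω) T :=
    (measurable_mixInt L hR (fun s hs => (hx'm s hs).mono (ℱ.le _) le_rfl)
      (fun s hs => (hε.measurable s hs).mono (ℱ.le _) le_rfl)).const_mul _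
  have hmarkov := mul_meas_ge_le_lintegral (μ := μ) hm (gaussInt L 0)
  have hm2 : ∫⁻ ω, c * mixInt L R (fun s => x' s ω) (fun s => ε s ω) T ∂μ
      ≤ c * gaussInt L 0 := by
    rw [lintegral_const_mul _ (measurable_mixInt L hR
      (fun s hs => (hx'm s hs).mono (ℱ.le _) le_rfl)
      (fun s hs => (hε.measurable s hs).mono (ℱ.le _) le_rfl))]
    gcongr
    exact lintegral_mixInt_le hε hR L hx'm hx'fin
  have h3 := (mul_le_mul_right (measure_mono (μ := μ) hsub) (gaussInt L 0)).trans
    (hmarkov.trans hm2)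
  rw [mul_comm c] at h3
  exact (ENNReal.mul_le_mul_iff_right (gaussInt_zero_ne_zero hL) (gaussInt_zero_ne_top hL)).1 h3

/-- With the Gaussian integrals evaluated, the hypothesis reads `δ * exp (‖S‖² / (2R²)) / √(det V) <
1 / √(det L)`; take logarithms. -/
theorem sq_matNorm_le_of_mixInt_lt {L : Matrix (Fin N) (Fin N) ℝ} (hL : L.PosDef) (hR : 0 < R)
    {x : ℕ → Fin N → ℝ} {e : ℕ → ℝ} {t : ℕ} {δ : ℝ} (hδ : 0 < δ)
    {V : Matrix (Fin N) (Fin N) ℝ} (hV : V.PosDef)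
    (hVdef : V = L + ∑ s ∈ Finset.range t, Matrix.vecMulVec (x s) (x s))
    (h : ENNReal.ofReal δ * mixInt L R x e t < gaussInt L 0) :
    matNorm V⁻¹ (∑ s ∈ Finset.range t, e s • x s) ^ 2
      ≤ R ^ 2 * (Real.log (V.det / L.det) + 2 * Real.log (1 / δ)) := by
  set S := ∑ s ∈ Finset.range t, e s • x s with hS
  rw [mixInt, ← hVdef, gaussInt_eq hV, gaussInt_zero_right hV, gaussInt_zero_right hL, ← mul_assoc,
    ← mul_assoc, ENNReal.mul_lt_mul_iff_left lintegral_exp_neg_sq_ne_zero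
    lintegral_exp_neg_sq_ne_top, ← ENNReal.ofReal_mul hδ.le, ← ENNReal.ofReal_mul (by positivity),
    ENNReal.ofReal_lt_ofReal_iff (inv_pos.2 (Real.sqrt_pos.2 hL.det_pos))] at h
  have hq : matNorm V⁻¹ (R⁻¹ • S) ^ 2 = (R ^ 2)⁻¹ * matNorm V⁻¹ S ^ 2 := by
    rw [sq_matNorm hV.inv.posSemidef, sq_matNorm hV.inv.posSemidef, Matrix.mulVec_smul,
      dotProduct_smul, smul_dotProduct, smul_eq_mul, smul_eq_mul, ← mul_assoc]
    congr 1
    rw [sq, mul_inv]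
  have hlog := Real.log_lt_log (by have := hV.det_pos; positivity) h
  have hVd := hV.det_pos
  have hLd := hL.det_pos
  rw [Real.log_mul (by positivity) (by positivity), Real.log_mul (by positivity) (by positivity),
    Real.log_exp, Real.log_inv, Real.log_inv, Real.log_sqrt hVd.le, Real.log_sqrt hLd.le, hq] at hlog
  rw [Real.log_div hVd.ne' hLd.ne', one_div, Real.log_inv]
  have hR2 : 0 < R ^ 2 := by positivity
  rw [← div_le_iff₀' hR2, div_eq_inv_mul]
  linarith

end Mixture

/-! ### Effective dimension, widths and the deterministic regret bound. -/

namespace SpectralBandit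

variable {N : ℕ} {Arm : Type*} {lam : ℝ} (P : SpectralBandit N Arm lam)

theorem lam_le_eig (i : Fin N) : lam ≤ P.eig i := P.isLeast_lam.2 ⟨i, rfl⟩

theorem eig_pos (i : Fin N) : 0 < P.eig i := P.lam_pos.trans_le (P.lam_le_eig i)

theorem posDef_Lam : P.Lam.PosDef := Matrix.PosDef.diagonal P.eig_pos

theorem posSemidef_sum_vecMulVec (a : ℕ → Arm) (t : ℕ) :
    (∑ s ∈ Finset.range t, Matrix.vecMulVec (P.feature (a s)) (P.feature (a s))).PosSemidef :=
  Matrix.posSemidef_sum _ fun s _ => by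
    simpa using Matrix.posSemidef_vecMulVec_self_star (P.feature (a s))

theorem posDef_gram (a : ℕ → Arm) (t : ℕ) : (P.gram a t).PosDef :=
  P.posDef_Lam.add_posSemidef (P.posSemidef_sum_vecMulVec a t)

theorem gram_zero (a : ℕ → Arm) : P.gram a 0 = P.Lam := by simp [gram]

theorem gram_succ (a : ℕ → Arm) (t : ℕ) :
    P.gram a (t + 1) = P.gram a t + Matrix.vecMulVec (P.feature (a t)) (P.feature (a t)) := by
  rw [gram, gram, Finset.sum_range_succ, add_assoc]

/-- The matrix determinant lemma makes the logarithm telescope. -/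
theorem log_det_gram_div (a : ℕ → Arm) (t : ℕ) :
    Real.log ((P.gram a t).det / P.Lam.det)
      = ∑ s ∈ Finset.range t, Real.log (1 + matNorm (P.gram a s)⁻¹ (P.feature (a s)) ^ 2) := by
  induction t with
  | zero => simp [gram_zero, P.posDef_Lam.det_pos.ne']
  | succ t ih =>
    have h1 := (P.posDef_gram a t).det_pos
    have h2 := P.posDef_Lam.det_pos
    rw [Finset.sum_range_succ, ← ih, gram_succ, Matrix.det_add_vecMulVec_self h1.ne'.isUnit,
      ← sq_matNorm (P.posDef_gram a t).inv.posSemidef, mul_div_right_comm,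
      Real.log_mul (by positivity) (by positivity)]

theorem sum_sq_feature_le (b : Arm) : ∑ i, P.feature b i ^ 2 ≤ 1 := by
  have h := P.norm_feature_le b
  have h2 : ‖WithLp.toLp 2 (P.feature b)‖ ^ 2 ≤ 1 := pow_le_one₀ (norm_nonneg _) h
  rw [EuclideanSpace.norm_sq_eq] at h2
  simpa using h2

theorem numZero_pos : 0 < P.numZero := by
  obtain ⟨i, hi⟩ := P.isLeast_lam.1
  rw [numZero, Finset.card_pos]
  exact ⟨i, by simp [hi]⟩

theorem logTerm_nonneg (T : ℕ) : 0 ≤ P.logTerm T := by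
  have := P.lam_pos
  refine Real.log_nonneg ?_
  have : 0 ≤ (T : ℝ) / (P.numZero * lam) := by positivity
  linarith

theorem logTerm_pos {T : ℕ} (hT : 0 < T) : 0 < P.logTerm T := by
  have := P.lam_pos
  have hK := P.numZero_pos
  refine Real.log_pos ?_
  have : 0 < (T : ℝ) / (P.numZero * lam) := by positivity
  linarith

/-- Needed because a real `sSup` dominates the members of a set only when the set is bounded above.
-/
theorem bddAbove_log_prod (T : ℕ) :
    BddAbove ((fun t : Fin N → ℝ => Real.log (∏ i, (1 + t i / P.eig i))) ''
      {t | (∀ i, 0 ≤ t i) ∧ ∑ i, t i = (T : ℝ)}) := by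
  refine ⟨Real.log (∏ i, (1 + T / P.eig i)), ?_⟩
  rintro _ ⟨t, ⟨ht0, hts⟩, rfl⟩
  have hpos : ∀ i, 0 < 1 + t i / P.eig i := fun i => by
    have := div_nonneg (ht0 i) (P.eig_pos i).le
    linarith
  refine Real.log_le_log (Finset.prod_pos fun i _ => hpos i)
    (Finset.prod_le_prod (fun i _ => (hpos i).le) fun i _ => ?_)
  have h1 : t i ≤ T := hts ▸ Finset.single_le_sum (fun j _ => ht0 j) (Finset.mem_univ i)
  have := P.eig_pos i
  gcongr

theorem log_prod_le_effDim_mul {T : ℕ} (hT : 0 < T) {t : Fin N → ℝ} (ht0 : ∀ i, 0 ≤ t i)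
    (hts : ∑ i, t i = T) :
    Real.log (∏ i, (1 + t i / P.eig i)) ≤ P.effDim T * P.logTerm T := by
  have h1 := le_csSup (P.bddAbove_log_prod T) (Set.mem_image_of_mem _ ⟨ht0, hts⟩)
  refine h1.trans ?_
  rw [← div_le_iff₀ (P.logTerm_pos hT)]
  exact Nat.le_ceil _

theorem log_det_gram_div_le {T t : ℕ} (ht : t ≤ T) (a : ℕ → Arm) :
    Real.log ((P.gram a t).det / P.Lam.det) ≤ P.effDim T * P.logTerm T := by
  rcases Nat.eq_zero_or_pos T with rfl | hT
  · obtain rfl : t = 0 := by omega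
    rw [log_det_gram_div]
    simpa using mul_nonneg (Nat.cast_nonneg _) (P.logTerm_nonneg 0)
  obtain ⟨i₀, -⟩ := P.isLeast_lam.1
  set τ : Fin N → ℝ := fun i => ∑ s ∈ Finset.range t, P.feature (a s) i ^ 2 with hτ
  have hτ0 : ∀ i, 0 ≤ τ i := fun i => Finset.sum_nonneg fun s _ => sq_nonneg _
  have hτs : ∑ i, τ i ≤ T := by
    rw [hτ, Finset.sum_comm]
    calc ∑ s ∈ Finset.range t, ∑ i, P.feature (a s) i ^ 2
        ≤ ∑ s ∈ Finset.range t, (1 : ℝ) := Finset.sum_le_sum fun s _ => P.sum_sq_feature_le _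
      _ ≤ T := by simpa using ht
  -- The maximum in `effDim` is over sums exactly `T`, so the missing mass goes to one coordinate,
  -- which only increases the product.
  set τ' : Fin N → ℝ := fun i => τ i + if i = i₀ then T - ∑ j, τ j else 0 with hτ'
  have hle : ∀ i, τ i ≤ τ' i := fun i => by
    simp only [hτ']
    split_ifs <;> linarith
  refine le_trans ?_ (P.log_prod_le_effDim_mul hT (t := τ') (fun i => (hτ0 i).trans (hle i)) ?_)
  · have hLd := P.posDef_Lam.det_pos
    have hdiag : ∀ i, P.gram a t i i = P.eig i + τ i := fun i => by
      simp [gram, Lam, hτ, Matrix.sum_apply, Matrix.vecMulVec_apply, sq]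
    refine Real.log_le_log (div_pos (P.posDef_gram a t).det_pos hLd) ?_
    rw [div_le_iff₀ hLd]
    refine (P.posDef_gram a t).det_le_prod_diag.trans ?_
    rw [Lam, Matrix.det_diagonal, ← Finset.prod_mul_distrib]
    refine Finset.prod_le_prod (fun i _ => (P.posDef_gram a t).diag_pos.le) fun i _ => ?_
    have h0 := P.eig_pos i
    rw [hdiag, add_mul, one_mul, div_mul_cancel₀ _ h0.ne']
    linarith [hle i]
  · simp [hτ', Finset.sum_add_distrib]

theorem min_one_le_two_mul_log {y : ℝ} (hy : 0 ≤ y) : min 1 y ≤ 2 * Real.log (1 + y) := by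
  have h := Real.le_log_one_add_of_nonneg hy
  have h2 : min 1 y ≤ 2 * (2 * y / (y + 2)) := by
    rw [mul_div_assoc', le_div_iff₀ (by linarith)]
    rcases le_total 1 y with h1 | h1
    · rw [min_eq_left h1]; linarith
    · rw [min_eq_right h1]; nlinarith
  linarith

theorem sum_min_sq_matNorm_le (T : ℕ) (a : ℕ → Arm) :
    ∑ t ∈ Finset.range T, min 1 (matNorm (P.gram a t)⁻¹ (P.feature (a t))) ^ 2
      ≤ 2 * (P.effDim T * P.logTerm T) := by
  refine le_trans ?_ (mul_le_mul_of_nonneg_left (P.log_det_gram_div_le le_rfl a) zero_le_two)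
  rw [log_det_gram_div, Finset.mul_sum]
  refine Finset.sum_le_sum fun t _ => ?_
  have hn := matNorm_nonneg (P.gram a t)⁻¹ (P.feature (a t))
  refine le_trans ?_ (min_one_le_two_mul_log (sq_nonneg _))
  refine le_min (pow_le_one₀ (le_min zero_le_one hn) (min_le_left _ _)) ?_
  exact pow_le_pow_left₀ (le_min zero_le_one hn) (min_le_right _ _) 2

theorem sum_min_matNorm_le (T : ℕ) (a : ℕ → Arm) :
    ∑ t ∈ Finset.range T, min 1 (matNorm (P.gram a t)⁻¹ (P.feature (a t)))
      ≤ √(2 * P.effDim T * T * P.logTerm T) := by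
  refine Real.le_sqrt_of_sq_le ?_
  have h1 := sq_sum_le_card_mul_sum_sq (s := Finset.range T)
    (f := fun t => min 1 (matNorm (P.gram a t)⁻¹ (P.feature (a t))))
  rw [Finset.card_range] at h1
  have h2 := mul_le_mul_of_nonneg_left (P.sum_min_sq_matNorm_le T a) (Nat.cast_nonneg (α := ℝ) T)
  linarith

variable {α : Fin N → ℝ} {a : ℕ → Arm} {e : ℕ → ℝ}

/-- The error splits into a noise term, controlled by the tail bound, and a regularization bias,
controlled by `‖α‖_Λ ≤ C`. -/
theorem estimate_sub (t : ℕ) :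
    P.estimate a (fun s => P.mean α (a s) + e s) t - α
      = (P.gram a t)⁻¹ *ᵥ (∑ s ∈ Finset.range t, e s • P.feature (a s))
        - (P.gram a t)⁻¹ *ᵥ (P.Lam *ᵥ α) := by
  have hU : IsUnit (P.gram a t).det := (P.posDef_gram a t).det_pos.ne'.isUnit
  have h1 : ∑ s ∈ Finset.range t, (P.mean α (a s) + e s) • P.feature (a s)
      = P.gram a t *ᵥ α - P.Lam *ᵥ α + ∑ s ∈ Finset.range t, e s • P.feature (a s) := by
    rw [gram, Matrix.add_mulVec, add_sub_cancel_left, Matrix.sum_mulVec, ← Finset.sum_add_distrib]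
    refine Finset.sum_congr rfl fun s _ => ?_
    rw [add_smul, Matrix.vecMulVec_mulVec, mean]
    simp
  rw [estimate, h1, Matrix.mulVec_add, Matrix.mulVec_sub, Matrix.mulVec_mulVec,
    Matrix.nonsing_inv_mul _ hU, Matrix.one_mulVec]
  abel

theorem abs_dotProduct_estimate_sub_mean_le (t : ℕ) (b : Arm) {ρ C : ℝ}
    (hρ : matNorm (P.gram a t)⁻¹ (∑ s ∈ Finset.range t, e s • P.feature (a s)) ≤ ρ)
    (hC : matNorm P.Lam α ≤ C) :
    |P.feature b ⬝ᵥ P.estimate a (fun s => P.mean α (a s) + e s) t - P.mean α b|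
      ≤ (ρ + C) * matNorm (P.gram a t)⁻¹ (P.feature b) := by
  have hinv := (P.posDef_gram a t).inv.posSemidef
  rw [mean, ← dotProduct_sub, estimate_sub, dotProduct_sub]
  have h1 := abs_dotProduct_mulVec_le_matNorm_mul hinv (P.feature b)
    (∑ s ∈ Finset.range t, e s • P.feature (a s))
  have h2 := abs_dotProduct_mulVec_le_matNorm_mul hinv (P.feature b) (P.Lam *ᵥ α)
  have h3 : matNorm (P.gram a t)⁻¹ (P.Lam *ᵥ α) ≤ C :=
    (matNorm_inv_add_mulVec_le P.posDef_Lam (P.posSemidef_sum_vecMulVec a t) α).trans hC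
  have hn := matNorm_nonneg (P.gram a t)⁻¹ (P.feature b)
  refine (abs_sub _ _).trans ?_
  nlinarith [mul_le_mul_of_nonneg_left hρ hn, mul_le_mul_of_nonneg_left h3 hn]

theorem regret_le_regretBound [Finite Arm] [Nonempty Arm] {T : ℕ} {R C δ : ℝ} (hR : 0 ≤ R)
    (hC : matNorm P.Lam α ≤ C) (hα : ∀ b, P.mean α b ∈ Set.Icc (-1 : ℝ) 1)
    (hUCB : P.IsSpectralUCB T R C δ a fun s => P.mean α (a s) + e s)
    (hρ : ∀ t < T, matNorm (P.gram a t)⁻¹ (∑ s ∈ Finset.range t, e s • P.feature (a s))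
      ≤ R * √(2 * P.effDim T * P.logTerm T + 8 * Real.log (1 / δ))) :
    P.regret α T a ≤ P.regretBound T R C δ := by
  set ρ := R * √(2 * P.effDim T * P.logTerm T + 8 * Real.log (1 / δ)) with hρdef
  have hρ0 : 0 ≤ ρ := by positivity
  have hC0 : 0 ≤ C := (matNorm_nonneg _ _).trans hC
  obtain ⟨v, hv⟩ := exists_eq_ciSup_of_finite (f := fun v => P.mean α v)
  have hround : ∀ t < T, P.mean α v - P.mean α (a t)
      ≤ (2 * ρ + 2 * C + 2) * min 1 (matNorm (P.gram a t)⁻¹ (P.feature (a t))) := by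
    intro t ht
    have h1 := abs_le.1 (P.abs_dotProduct_estimate_sub_mean_le t v (hρ t ht) hC)
    have h2 := abs_le.1 (P.abs_dotProduct_estimate_sub_mean_le t (a t) (hρ t ht) hC)
    have h3 := hUCB t ht v
    simp only [ucb, confidence, ← hρdef] at h3
    have hn := matNorm_nonneg (P.gram a t)⁻¹ (P.feature (a t))
    -- If the width is at least 1, the gap is at most 2 because means lie in `[-1, 1]`; this is the
    -- source of the summand 2. Otherwise optimism bounds the gap by `2 (ρ + C)` times the width of
    -- the played arm.
    rcases le_total 1 (matNorm (P.gram a t)⁻¹ (P.feature (a t))) with h | h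
    · rw [min_eq_left h]
      linarith [(hα v).2, (hα (a t)).1]
    · rw [min_eq_right h]
      nlinarith
  have hreg : P.regret α T a = ∑ t ∈ Finset.range T, (P.mean α v - P.mean α (a t)) := by
    rw [regret, ← hv, Finset.sum_sub_distrib]
    simp
  rw [hreg]
  calc ∑ t ∈ Finset.range T, (P.mean α v - P.mean α (a t))
      ≤ ∑ t ∈ Finset.range T,
          (2 * ρ + 2 * C + 2) * min 1 (matNorm (P.gram a t)⁻¹ (P.feature (a t))) :=
        Finset.sum_le_sum fun t ht => hround t (Finset.mem_range.1 ht)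
    _ ≤ (2 * ρ + 2 * C + 2) * √(2 * P.effDim T * T * P.logTerm T) := by
        rw [← Finset.mul_sum]
        exact mul_le_mul_of_nonneg_left (P.sum_min_matNorm_le T a) (by linarith)
    _ = P.regretBound T R C δ := by
        rw [regretBound, hρdef]
        ring

end SpectralBandit

/-! ### The high-probability event, including noiseless rewards. -/

theorem IsCondSubGaussianNoise.ae_eq_zero {Ω : Type*} {mΩ : MeasurableSpace Ω} {μ : Measure Ω}
    [IsProbabilityMeasure μ] {ℱ : Filtration ℕ mΩ} {T : ℕ} {ε : ℕ → Ω → ℝ}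
    (hε : IsCondSubGaussianNoise μ ℱ T 0 ε) {t : ℕ} (ht : t < T) : ∀ᵐ ω ∂μ, ε t ω = 0 := by
  have hm : Measurable (ε t) := (hε.measurable t ht).mono (ℱ.le _) le_rfl
  have hi1 : Integrable (fun ω => Real.exp (ε t ω)) μ := by
    simpa using hε.integrable_exp t ht 1
  have hi2 : Integrable (fun ω => Real.exp (-ε t ω)) μ := by
    simpa using hε.integrable_exp t ht (-1)
  have hi : Integrable (ε t) μ := by
    refine (hi1.add hi2).mono' hm.aestronglyMeasurable (Filter.Eventually.of_forall fun ω => ?_)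
    have h1 := Real.add_one_le_exp (ε t ω)
    have h2 := Real.add_one_le_exp (-ε t ω)
    have h3 := Real.exp_pos (ε t ω)
    have h4 := Real.exp_pos (-ε t ω)
    simp only [Pi.add_apply, Real.norm_eq_abs]
    exact abs_le.2 ⟨by linarith, by linarith⟩
  have h0 : ∫ ω, ε t ω ∂μ = 0 := by
    rw [← integral_condExp (ℱ.le t), integral_congr_ae (hε.condExp_eq_zero t ht)]
    simp
  have h1 : ∫ ω, Real.exp (ε t ω) ∂μ ≤ 1 := by
    have h := hε.condExp_exp_le t ht 1
    simp only [one_mul] at h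
    rw [← integral_condExp (ℱ.le t)]
    refine (integral_mono_ae integrable_condExp (integrable_const _) h).trans ?_
    simp
  have hnn : ∀ ω, 0 ≤ Real.exp (ε t ω) - (ε t ω + 1) := fun ω =>
    sub_nonneg.2 (Real.add_one_le_exp _)
  have hi3 : Integrable (fun ω => ε t ω + 1) μ := hi.add (integrable_const 1)
  have hint : Integrable (fun ω => Real.exp (ε t ω) - (ε t ω + 1)) μ := hi1.sub hi3
  -- Since `𝔼 exp ε ≤ 1 = 𝔼 (1 + ε)` while `exp x ≥ 1 + x` with equality only at 0, the noise
  -- vanishes almost surely.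
  have hz : ∫ ω, (Real.exp (ε t ω) - (ε t ω + 1)) ∂μ = 0 := by
    refine le_antisymm ?_ (integral_nonneg hnn)
    rw [integral_sub hi1 hi3, integral_add hi (integrable_const 1), h0]
    simpa using h1
  rw [integral_eq_zero_iff_of_nonneg hnn hint] at hz
  filter_upwards [hz] with ω hω
  by_contra hne
  have := Real.add_one_lt_exp hne
  simp only [Pi.zero_apply] at hω
  linarith

namespace SpectralBandit

variable {N : ℕ} {Arm : Type*} {lam : ℝ} (P : SpectralBandit N Arm lam)

theorem one_sub_le_measure_matNorm_noise_le [Finite Arm] {Ω : Type*} {mΩ : MeasurableSpace Ω}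
    {μ : Measure Ω} [IsProbabilityMeasure μ] {ℱ : Filtration ℕ mΩ} {T : ℕ} {R δ : ℝ} (hR : 0 ≤ R)
    (hδ0 : 0 < δ) (hδ1 : δ < 1) {ε : ℕ → Ω → ℝ} {a : ℕ → Ω → Arm}
    (hε : IsCondSubGaussianNoise μ ℱ T R ε)
    (ha : ∀ t < T, ∀ b, MeasurableSet[ℱ t] {ω | a t ω = b}) :
    1 - δ ≤ μ.real {ω | ∀ t ≤ T, matNorm (P.gram (fun s => a s ω) t)⁻¹
        (∑ s ∈ Finset.range t, ε s ω • P.feature (a s ω))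
      ≤ R * √(P.effDim T * P.logTerm T + 2 * Real.log (1 / δ))} := by
  have hlog : 0 ≤ Real.log (1 / δ) := Real.log_nonneg ((one_le_div hδ0).2 hδ1.le)
  have hdL : 0 ≤ P.effDim T * P.logTerm T := mul_nonneg (Nat.cast_nonneg _) (P.logTerm_nonneg T)
  -- The mixture divides by `R`, so `R = 0` is treated apart.
  rcases hR.eq_or_lt with rfl | hRpos
  · have hae : ∀ᵐ ω ∂μ, ∀ t, t < T → ε t ω = 0 :=
      ae_all_iff.2 fun t => by
        by_cases ht : t < T
        · filter_upwards [hε.ae_eq_zero ht] with ω hω _ using hω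
        · exact Filter.Eventually.of_forall fun ω h => absurd h ht
    have h1 : μ.real {ω | ∀ t ≤ T, matNorm (P.gram (fun s => a s ω) t)⁻¹
        (∑ s ∈ Finset.range t, ε s ω • P.feature (a s ω))
        ≤ 0 * √(P.effDim T * P.logTerm T + 2 * Real.log (1 / δ))} = 1 := by
      rw [← probReal_univ (μ := μ)]
      refine measureReal_congr (Filter.eventuallyEq_univ.2 ?_)
      filter_upwards [hae] with ω hω t ht
      have hS : ∑ s ∈ Finset.range t, ε s ω • P.feature (a s ω) = 0 :=
        Finset.sum_eq_zero fun s hs => by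
          rw [hω s ((Finset.mem_range.1 hs).trans_le ht), zero_smul]
      rw [hS]
      simp [matNorm]
    rw [h1]
    linarith
  · let _ : MeasurableSpace Arm := ⊤
    have hx : ∀ t < T, Measurable[ℱ t] fun ω => P.feature (a t ω) := fun t ht => by
      have hat : Measurable[ℱ t] (a t) := by
        refine @measurable_to_countable' Arm Ω _ _ (ℱ t) _ fun b => ?_
        exact ha t ht b
      exact (measurable_from_top (f := P.feature)).comp hat
    have hfin : ∀ t < T, (Set.range fun ω => P.feature (a t ω)).Finite := fun t _ =>
      (Set.finite_range P.feature).subset (by rintro _ ⟨ω, rfl⟩; exact ⟨_, rfl⟩)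
    have hmax := measure_exists_mixInt_ge_le hε hRpos.ne' P.posDef_Lam hx hfin (ENNReal.ofReal δ)
    set bad := {ω | ∃ t ≤ T, gaussInt P.Lam 0 ≤ ENNReal.ofReal δ *
      mixInt P.Lam R (fun s => P.feature (a s ω)) (fun s => ε s ω) t} with hbad
    have hbad' : 1 - δ ≤ μ.real badᶜ := by
      -- Subadditivity is enough here, so measurability of `bad` is not needed.
      have h1 : μ.real Set.univ ≤ μ.real bad + μ.real badᶜ := by
        rw [← Set.union_compl_self bad]
        exact measureReal_union_le _ _
      have h2 : μ.real bad ≤ δ := ENNReal.toReal_le_of_le_ofReal hδ0.le hmax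
      rw [probReal_univ] at h1
      linarith
    refine hbad'.trans (measureReal_mono fun ω hω t ht => ?_)
    have hlt : ENNReal.ofReal δ *
        mixInt P.Lam R (fun s => P.feature (a s ω)) (fun s => ε s ω) t < gaussInt P.Lam 0 := by
      by_contra hcon
      exact hω ⟨t, ht, not_lt.1 hcon⟩
    have hsq := sq_matNorm_le_of_mixInt_lt P.posDef_Lam hRpos hδ0
      (P.posDef_gram (fun s => a s ω) t) rfl hlt
    have hdet := P.log_det_gram_div_le ht fun s => a s ω
    rw [← Real.sqrt_sq hR, ← Real.sqrt_mul (sq_nonneg R)]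
    refine Real.le_sqrt_of_sq_le (hsq.trans ?_)
    gcongr

/-! ### Growth of the bound in `T`, and the conclusion. -/

theorem logTerm_le {T : ℕ} (hT : 2 ≤ T) :
    P.logTerm T ≤ (1 + Real.log (1 + 1 / lam) / Real.log 2) * Real.log T := by
  have hlam := P.lam_pos
  have hK : (1 : ℝ) ≤ P.numZero := by exact_mod_cast P.numZero_pos
  have hT2 : (2 : ℝ) ≤ T := by exact_mod_cast hT
  have hl2 : 0 < Real.log 2 := Real.log_pos (by norm_num)
  have hlT : Real.log 2 ≤ Real.log T := Real.log_le_log (by norm_num) hT2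
  have h1 : P.logTerm T ≤ Real.log (T * (1 + 1 / lam)) := by
    refine Real.log_le_log (by positivity) ?_
    have h2 : (T : ℝ) / (P.numZero * lam) ≤ T / lam := by
      apply div_le_div_of_nonneg_left (by positivity) hlam
      nlinarith
    rw [mul_add, mul_one, mul_one_div]
    linarith
  rw [Real.log_mul (by positivity) (by positivity)] at h1
  have h3 : 0 ≤ Real.log (1 + 1 / lam) := Real.log_nonneg (by
    have : 0 ≤ 1 / lam := by positivity
    linarith)
  have h4 : Real.log (1 + 1 / lam) ≤ Real.log (1 + 1 / lam) / Real.log 2 * Real.log T := by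
    rw [div_mul_eq_mul_div, le_div_iff₀ hl2]
    exact mul_le_mul_of_nonneg_left hlT h3
  linarith

/-- When `d ≥ 1`, `d log T ≥ log 2`, so additive constants are absorbed into `√(d log T)`. Each of
the two factors of the bound contributes one such root, whence `d` and the exponent `p = 1`. -/
theorem regretBound_le {R C δ : ℝ} (hR : 0 ≤ R) (hδ0 : 0 < δ) (hδ1 : δ < 1) (hC : 0 ≤ C) {T : ℕ}
    (hT : 2 ≤ T) :
    P.regretBound T R C δ ≤
      (2 * R * √(2 * (1 + Real.log (1 + 1 / lam) / Real.log 2)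
          + 8 * Real.log (1 / δ) / Real.log 2) + (2 * C + 2) * √(1 / Real.log 2)) *
        √(2 * (1 + Real.log (1 + 1 / lam) / Real.log 2)) *
        (P.effDim T * √T) * Real.log T ^ 1 := by
  have hlam := P.lam_pos
  have hT2 : (2 : ℝ) ≤ T := by exact_mod_cast hT
  have hl2 : 0 < Real.log 2 := Real.log_pos (by norm_num)
  have hlT : Real.log 2 ≤ Real.log T := Real.log_le_log (by norm_num) hT2
  have hlog : 0 ≤ Real.log (1 / δ) := Real.log_nonneg ((one_le_div hδ0).2 hδ1.le)
  have h3 : 0 ≤ Real.log (1 + 1 / lam) := Real.log_nonneg (by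
    have : 0 ≤ 1 / lam := by positivity
    linarith)
  have hL := P.logTerm_le hT
  set κ := 1 + Real.log (1 + 1 / lam) / Real.log 2 with hκ
  have hκ0 : 0 ≤ κ := by positivity
  set ℓ := Real.log T with hℓ
  have hℓ0 : 0 < ℓ := hl2.trans_le hlT
  rcases Nat.eq_zero_or_pos (P.effDim T) with hd | hd
  -- Both sides vanish when `d = 0`.
  · simp [regretBound, hd]
  set d : ℝ := (P.effDim T : ℝ) with hdd
  have hd1 : 1 ≤ d := Nat.one_le_cast.2 hd
  have hdℓ : Real.log 2 ≤ d * ℓ := by nlinarith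
  have hA : √(2 * d * P.logTerm T + 8 * Real.log (1 / δ))
      ≤ √(2 * κ + 8 * Real.log (1 / δ) / Real.log 2) * √(d * ℓ) := by
    rw [← Real.sqrt_mul (by positivity)]
    refine Real.sqrt_le_sqrt ?_
    have h5 : 8 * Real.log (1 / δ) ≤ 8 * Real.log (1 / δ) / Real.log 2 * (d * ℓ) := by
      rw [div_mul_eq_mul_div, le_div_iff₀ hl2]
      exact mul_le_mul_of_nonneg_left hdℓ (by positivity)
    have h6 : 2 * d * P.logTerm T ≤ 2 * d * (κ * ℓ) :=
      mul_le_mul_of_nonneg_left hL (by positivity)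
    linarith
  have hB : 1 ≤ √(1 / Real.log 2) * √(d * ℓ) := by
    rw [← Real.sqrt_mul (by positivity)]
    refine Real.one_le_sqrt.2 ?_
    rw [one_div_mul_eq_div, one_le_div hl2]
    exact hdℓ
  have hD : √(2 * d * T * P.logTerm T) ≤ √(2 * κ) * √(d * ℓ) * √T := by
    rw [← Real.sqrt_mul (by positivity), ← Real.sqrt_mul (by positivity)]
    refine Real.sqrt_le_sqrt ?_
    have h6 : 2 * d * T * P.logTerm T ≤ 2 * d * T * (κ * ℓ) :=
      mul_le_mul_of_nonneg_left hL (by positivity)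
    linarith
  have hE : 2 * R * √(2 * d * P.logTerm T + 8 * Real.log (1 / δ)) + 2 * C + 2
      ≤ (2 * R * √(2 * κ + 8 * Real.log (1 / δ) / Real.log 2)
        + (2 * C + 2) * √(1 / Real.log 2)) * √(d * ℓ) := by
    have h7 := mul_le_mul_of_nonneg_left hA (by positivity : 0 ≤ 2 * R)
    have h8 := mul_le_mul_of_nonneg_left hB (by positivity : 0 ≤ 2 * C + 2)
    linarith
  have hs : √(d * ℓ) * √(d * ℓ) = d * ℓ := Real.mul_self_sqrt (by positivity)
  rw [regretBound, ← hdd]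
  refine (mul_le_mul hE hD (Real.sqrt_nonneg _) (by positivity)).trans (le_of_eq ?_)
  rw [pow_one]
  linear_combination (2 * R * √(2 * κ + 8 * Real.log (1 / δ) / Real.log 2)
        + (2 * C + 2) * √(1 / Real.log 2)) * √(2 * κ) * √T * hs

end SpectralBandit

theorem mainTheorem2 (R C lam δ : ℝ) (hR : 0 ≤ R) (hδ0 : 0 < δ) (hδ1 : δ < 1) :
    ∃ (A : ℝ) (p : ℕ), ∀ (N : ℕ) (Arm : Type*) [Finite Arm] [Nonempty Arm]
      (P : SpectralBandit N Arm lam) (T : ℕ) (α : Fin N → ℝ),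
      matNorm P.Lam α ≤ C →
      (∀ a, P.mean α a ∈ Set.Icc (-1 : ℝ) 1) →
      (∀ (Ω : Type*) (mΩ : MeasurableSpace Ω) (μ : Measure Ω) [IsProbabilityMeasure μ]
        (ℱ : Filtration ℕ mΩ) (ε : ℕ → Ω → ℝ) (a : ℕ → Ω → Arm),
        IsCondSubGaussianNoise μ ℱ T R ε →
        (∀ t < T, ∀ b, MeasurableSet[ℱ t] {ω | a t ω = b}) →
        (∀ ω, P.IsSpectralUCB T R C δ (fun t => a t ω)
          (fun t => P.mean α (a t ω) + ε t ω)) →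
        1 - δ ≤ μ.real {ω | P.regret α T (fun t => a t ω) ≤ P.regretBound T R C δ}) ∧
      (2 ≤ T → P.regretBound T R C δ ≤ A * (P.effDim T * √T) * Real.log T ^ p) := by
  -- The constant `A` is read off from `regretBound_le`; it involves only `R`, `C`, `lam` and `δ`.
  refine ⟨_, 1, fun N Arm _ _ P T α hC hα => ⟨fun Ω mΩ μ _ ℱ ε a hε ha hUCB => ?_, fun hT =>
    P.regretBound_le hR hδ0 hδ1 ((matNorm_nonneg _ _).trans hC) hT⟩⟩
  refine (P.one_sub_le_measure_matNorm_noise_le hR hδ0 hδ1 hε ha).trans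
    (measureReal_mono fun ω hω => ?_)
  refine P.regret_le_regretBound hR hC hα (hUCB ω) fun t ht => (hω t ht.le).trans ?_
  have hlog : 0 ≤ Real.log (1 / δ) := Real.log_nonneg ((one_le_div hδ0).2 hδ1.le)
  have hdL : 0 ≤ P.effDim T * P.logTerm T := mul_nonneg (Nat.cast_nonneg _) (P.logTerm_nonneg T)
  -- The tail bound gives `dL + 2 log (1/δ)` under the root, with `L = logTerm T`, well within the
  -- algorithm's `2dL + 8 log (1/δ)`.
  refine mul_le_mul_of_nonneg_left (Real.sqrt_le_sqrt ?_) hR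
  linarith
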